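/- Let $A$ be a unital $C^*$-algebra and let $H$ be a finite-dimensional $C^*$-Hopf algebra, with comultiplication $\Delta$ (Sweedler notation $\Delta(h)=h_{(1)}\otimes h_{(2)}$) and counit $\epsilon$. A weak coaction of $H$ on $A$ is a unital $*$-homomorphism $\rho\colon A\to A\otimes H$ with $(\mathrm{id}\otimes\epsilon)(\rho(a))=a$ for all $a\in A$. Put $A^{\infty}=\ell^{\infty}(\mathbb N,A)/c_0(A)$, identify $A$ with the classes of constant sequences in $A^\infty$, let $A_{\infty}=A^{\infty}\cap A'$, and let $\rho^{\infty}\colon A^{\infty}\to A^{\infty}\otimes H=(A\otimes H)^\infty$ be given by $\rho^\infty((a_n))=(\rho(a_n))$. Suppose that there is a weak coaction $\rho$ of $H$ on $A$ with the Rohlin property in the following sense: there is a unital injective $*$-homomorphism $\pi\colon H\to A_{\infty}$ such that $\rho^{\infty}(\pi(h))=\pi(h_{(1)})\otimes h_{(2)}$ for all $h\in H$. Then $H$ is commutative. -/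

import Mathlib

open scoped TensorProduct BoundedContinuousFunction

/-- A `C*`-Hopf algebra (finite-dimensionality is imposed separately): a unital `C*`-algebra which
is a Hopf algebra over `ℂ` and whose comultiplication is a `*`-homomorphism. (That the counit is a
`*`-homomorphism and that the antipode satisfies `S (star (S (star h))) = h` follow.) -/
class CStarHopfAlgebra (H : Type*) extends CStarAlgebra H, HopfAlgebra ℂ H where
  comul_star : ∀ h : H, comul (star h) = Star.star (comul h)

noncomputable section

namespace CStarHopf

section Slice

variable (A : Type*) {H : Type*} [AddCommGroup A] [Module ℂ A] [AddCommGroup H] [Module ℂ H]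

/-- The slice map `id ⊗ φ : A ⊗ H → A`. -/
def slice (φ : H →ₗ[ℂ] ℂ) : A ⊗[ℂ] H →ₗ[ℂ] A :=
  (TensorProduct.rid ℂ A).toLinearMap ∘ₗ φ.lTensor A

@[simp]
theorem slice_tmul (φ : H →ₗ[ℂ] ℂ) (a : A) (h : H) : slice A φ (a ⊗ₜ h) = φ h • a := by
  simp [slice]

end Slice

section SequenceAlgebra

variable (A : Type*) [CStarAlgebra A]

/-- The two-sided ideal `c₀(A)` of sequences tending to `0` in `ℓ^∞(ℕ, A)`. -/
def c0 : Ideal (ℕ →ᵇ A) where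
  carrier := {a | Filter.Tendsto (fun n => ‖a n‖) Filter.atTop (nhds 0)}
  zero_mem' := by simp
  add_mem' {a b} ha hb := by
    refine squeeze_zero (fun _ => norm_nonneg _) (fun n => norm_add_le (a n) (b n)) ?_
    simpa using Filter.Tendsto.add ha hb
  smul_mem' c a ha := by
    have h : Filter.Tendsto (fun n => ‖c‖ * ‖a n‖) Filter.atTop (nhds 0) := by
      simpa using Filter.Tendsto.const_mul ‖c‖ ha
    refine squeeze_zero (fun _ => norm_nonneg _) (fun n => ?_) h
    exact (norm_mul_le (c n) (a n)).trans
      (mul_le_mul_of_nonneg_right (c.norm_coe_le_norm n) (norm_nonneg _))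

variable {A}

theorem mem_c0 {a : ℕ →ᵇ A} :
    a ∈ c0 A ↔ Filter.Tendsto (fun n => ‖a n‖) Filter.atTop (nhds 0) := Iff.rfl

variable (A)

instance : (c0 A).IsTwoSided where
  mul_mem_of_left {a} c ha := by
    have h : Filter.Tendsto (fun n => ‖a n‖ * ‖c‖) Filter.atTop (nhds 0) := by
      simpa using Filter.Tendsto.mul_const ‖c‖ (mem_c0.1 ha)
    refine squeeze_zero (fun _ => norm_nonneg _) (fun n => ?_) h
    exact (norm_mul_le (a n) (c n)).trans
      (mul_le_mul_of_nonneg_left (c.norm_coe_le_norm n) (norm_nonneg _))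

/-- The sequence algebra `A^∞ = ℓ^∞(ℕ, A) / c₀(A)`. -/
abbrev AInf : Type _ := (ℕ →ᵇ A) ⧸ c0 A

variable {A} in
theorem star_mem_c0 {a : ℕ →ᵇ A} (ha : a ∈ c0 A) : star a ∈ c0 A := by
  rw [mem_c0] at ha ⊢
  simpa using ha

/-- The involution of `A^∞`, induced by the pointwise involution of `ℓ^∞(ℕ, A)`. -/
instance : StarRing (AInf A) where
  star := Quotient.map' star fun a b hab => by
    rw [Submodule.quotientRel_def] at hab ⊢
    simpa using star_mem_c0 hab
  star_involutive x := by
    obtain ⟨a, rfl⟩ := Ideal.Quotient.mk_surjective x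
    exact congrArg (Ideal.Quotient.mk (c0 A)) (star_star a)
  star_mul x y := by
    obtain ⟨a, rfl⟩ := Ideal.Quotient.mk_surjective x
    obtain ⟨b, rfl⟩ := Ideal.Quotient.mk_surjective y
    exact congrArg (Ideal.Quotient.mk (c0 A)) (star_mul a b)
  star_add x y := by
    obtain ⟨a, rfl⟩ := Ideal.Quotient.mk_surjective x
    obtain ⟨b, rfl⟩ := Ideal.Quotient.mk_surjective y
    exact congrArg (Ideal.Quotient.mk (c0 A)) (star_add a b)

instance : StarModule ℂ (AInf A) where
  star_smul c x := by
    obtain ⟨a, rfl⟩ := Ideal.Quotient.mk_surjective x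
    exact congrArg (Ideal.Quotient.mk (c0 A)) (star_smul c a)

/-- The quotient map `ℓ^∞(ℕ, A) → A^∞`. -/
def toAInf : (ℕ →ᵇ A) →⋆ₐ[ℂ] AInf A where
  __ := Ideal.Quotient.mkₐ ℂ (c0 A)
  map_star' _ := rfl

theorem toAInf_surjective : Function.Surjective (toAInf A) :=
  Ideal.Quotient.mk_surjective

variable {A} in
theorem toAInf_eq_zero {a : ℕ →ᵇ A} :
    toAInf A a = 0 ↔ Filter.Tendsto (fun n => ‖a n‖) Filter.atTop (nhds 0) :=
  Ideal.Quotient.eq_zero_iff_mem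

/-- The central sequence algebra `A_∞ = A^∞ ∩ A'`, where `A ⊆ A^∞` as (classes of) constant
sequences. -/
def centralSeq : StarSubalgebra ℂ (AInf A) :=
  StarSubalgebra.centralizer ℂ
    (Set.range fun a : A => toAInf A (BoundedContinuousFunction.const ℕ a))

/-- A sanity lemma for the definition of `A_∞`. -/
theorem mem_centralSeq {x : AInf A} :
    x ∈ centralSeq A ↔ ∀ a : A, toAInf A (BoundedContinuousFunction.const ℕ a) * x =
      x * toAInf A (BoundedContinuousFunction.const ℕ a) := by
  rw [centralSeq, StarSubalgebra.mem_centralizer_iff]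
  constructor
  · intro h a
    exact (h _ ⟨a, rfl⟩).1
  · rintro h _ ⟨a, rfl⟩
    refine ⟨h a, ?_⟩
    have : star (toAInf A (BoundedContinuousFunction.const ℕ a)) =
        toAInf A (BoundedContinuousFunction.const ℕ (star a)) := by
      rw [← map_star]; rfl
    simpa [this] using h (star a)

variable {A}

/-- The linear map `A^∞ → A^∞`, `(aₙ) ↦ (T aₙ)` induced by a bounded linear map `T : A → A`. -/
def mapInf (T : A →L[ℂ] A) : AInf A →ₗ[ℂ] AInf A :=
  (((c0 A).restrictScalars ℂ).liftQ
      ((toAInf A).toAlgHom.toLinearMap ∘ₗ (T.compLeftContinuousBounded ℕ).toLinearMap)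
      (fun a ha => by
        rw [LinearMap.mem_ker]
        refine toAInf_eq_zero.2 ?_
        have h : Filter.Tendsto (fun n => ‖T‖ * ‖a n‖) Filter.atTop (nhds 0) := by
          simpa using Filter.Tendsto.const_mul ‖T‖ (mem_c0.1 ha)
        exact squeeze_zero (fun _ => norm_nonneg _) (fun n => T.le_opNorm (a n)) h)) ∘ₗ
    (Submodule.Quotient.restrictScalarsEquiv ℂ (c0 A)).symm.toLinearMap

theorem mapInf_toAInf (T : A →L[ℂ] A) (a : ℕ →ᵇ A) :
    mapInf T (toAInf A a) = toAInf A (T.compLeftContinuousBounded ℕ a) := rfl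

end SequenceAlgebra

section Functional

variable {H : Type*} [CStarAlgebra H] [FiniteDimensional ℂ H]

open scoped ComplexOrder

theorem roots_charpoly_mulLeft_nonneg (h : H) {z : ℂ}
    (hz : z ∈ (LinearMap.charpoly (LinearMap.mulLeft ℂ (star h * h))).roots) : 0 ≤ z := by
  have hz' := Polynomial.isRoot_of_mem_roots hz
  rw [← Module.End.mem_spectrum_iff_isRoot_charpoly] at hz'
  have hz1 : z ∈ spectrum ℂ (star h * h) :=
    AlgHom.spectrum_apply_subset (Algebra.lmul ℂ H) (star h * h) hz'
  have hsa : IsSelfAdjoint (star h * h) := IsSelfAdjoint.star_mul_self h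
  have hre := hsa.mem_spectrum_eq_re hz1
  have hz2 : z.re ∈ spectrum ℝ (star h * h) := by
    rw [← spectrum.algebraMap_mem_iff ℂ]
    simpa [← hre] using hz1
  rw [hre]
  exact_mod_cast spectrum_star_mul_self_nonneg _ hz2

/-- The trace of the left regular representation, a faithful positive functional on `H`. -/
def regTrace : H →ₗ[ℂ] ℂ := LinearMap.trace ℂ H ∘ₗ LinearMap.mul ℂ H

theorem regTrace_eq_sum_roots (h : H) : regTrace h =
    (LinearMap.charpoly (LinearMap.mulLeft ℂ h)).roots.sum :=
  Module.End.trace_eq_sum_roots_charpoly_of_splits (IsAlgClosed.splits _)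

theorem regTrace_star_mul_self_nonneg (h : H) : 0 ≤ regTrace (star h * h) := by
  rw [regTrace_eq_sum_roots]
  exact Multiset.sum_nonneg fun z hz => roots_charpoly_mulLeft_nonneg h hz

theorem regTrace_faithful {h : H} (h0 : regTrace (star h * h) = 0) : h = 0 := by
  rw [regTrace_eq_sum_roots] at h0
  have hz : ∀ z ∈ (LinearMap.charpoly (LinearMap.mulLeft ℂ (star h * h))).roots, z = 0 := by
    intro z hz
    refine le_antisymm ?_ (roots_charpoly_mulLeft_nonneg h hz)
    rw [← h0]
    exact Multiset.single_le_sum (fun z hz => roots_charpoly_mulLeft_nonneg h hz) z hz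
  have hspec : spectrum ℂ (star h * h) ⊆ {0} := by
    intro z hz1
    refine hz z ?_
    rw [Polynomial.mem_roots (LinearMap.charpoly_monic _).ne_zero,
      ← Module.End.mem_spectrum_iff_isRoot_charpoly]
    intro hu
    refine hz1 (Algebra.lmul_isUnit_iff (R := ℂ).1 ?_)
    rwa [map_sub, AlgHom.commutes]
  have hn : IsStarNormal (star h * h) := (IsSelfAdjoint.star_mul_self h).isStarNormal
  exact CStarRing.star_mul_self_eq_zero_iff h |>.1
    (CFC.eq_zero_of_spectrum_subset_zero (star h * h) hspec)

theorem regTrace_star (h : H) : regTrace (star h) = star (regTrace h) := by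
  have key : ∀ x : H, (regTrace (star x * x)).im = 0 := fun x =>
    (Complex.nonneg_iff.1 (regTrace_star_mul_self_nonneg x)).2.symm
  have h1 := key (1 + h)
  have h2 := key (1 + Complex.I • h)
  have h3 := key h
  have h4 := key 1
  simp only [star_add, star_one, star_smul, add_mul, mul_add, one_mul, mul_one, map_add, map_smul,
    smul_mul_assoc, mul_smul_comm, Complex.add_im, smul_eq_mul, Complex.mul_im, Complex.mul_re] at h1 h2 h4
  simp at h1 h2 h4
  apply Complex.ext
  · simp
    linarith
  · simp
    linarith

/-- The sesquilinear form of `regTrace` is a sum of squares of functionals spanning the dual. -/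
theorem exists_separating_functionals : ∃ (m : ℕ) (f : Fin m → H →ₗ[ℂ] ℂ),
    (∀ x y : H, regTrace (star x * y) = ∑ k, star (f k x) * f k y) ∧
    ∀ φ : H →ₗ[ℂ] ℂ, ∃ c : Fin m → ℂ, φ = ∑ k, c k • f k := by
  classical
  let b := Module.finBasis ℂ H
  let G : Matrix (Fin (Module.finrank ℂ H)) (Fin (Module.finrank ℂ H)) ℂ :=
    Matrix.of fun i j => regTrace (star (b i) * b j)
  have hG2 : ∀ x y : H, regTrace (star x * y) =
      ∑ i, ∑ j, star (b.repr x i) * G i j * b.repr y j := by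
    intro x y
    conv_lhs => rw [← b.sum_repr x, ← b.sum_repr y]
    simp only [star_sum, star_smul, Finset.sum_mul, Finset.mul_sum, map_sum, smul_mul_assoc,
      mul_smul_comm, map_smul, smul_eq_mul, G, Matrix.of_apply]
    refine Finset.sum_comm.trans (Finset.sum_congr rfl fun i _ => Finset.sum_congr rfl fun j _ => ?_)
    ring
  have hG : G.PosSemidef := by
    refine Matrix.PosSemidef.of_dotProduct_mulVec_nonneg ?_ ?_
    · ext i j
      simp [G, ← regTrace_star]
    · intro x
      have := regTrace_star_mul_self_nonneg (∑ i, x i • b i)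
      rw [hG2] at this
      simp only [b.repr_sum_self] at this
      simpa [dotProduct, Matrix.mulVec, Finset.mul_sum, mul_assoc] using this
  obtain ⟨m, v, hv⟩ := Matrix.posSemidef_iff_eq_sum_vecMulVec.1 hG
  let f : Fin m → H →ₗ[ℂ] ℂ := fun k => ∑ j, star (v k j) • b.coord j
  have hf : ∀ x y : H, regTrace (star x * y) = ∑ k, star (f k x) * f k y := by
    intro x y
    rw [hG2, hv]
    simp only [Matrix.sum_apply, Matrix.vecMulVec_apply, f, LinearMap.sum_apply,
      LinearMap.smul_apply, Module.Basis.coord_apply, smul_eq_mul, star_sum, star_mul', star_star,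
      Finset.sum_mul, Finset.mul_sum, Pi.star_apply]
    rw [Finset.sum_congr rfl fun i _ => Finset.sum_comm, Finset.sum_comm]
    refine Finset.sum_congr rfl fun k _ => ?_
    refine Finset.sum_comm.trans
      (Finset.sum_congr rfl fun i _ => Finset.sum_congr rfl fun j _ => ?_)
    ring
  refine ⟨m, f, hf, fun φ => ?_⟩
  have hinj : LinearMap.ker (LinearMap.pi f) = ⊥ := by
    rw [LinearMap.ker_eq_bot']
    intro x hx
    refine regTrace_faithful ?_
    rw [hf]
    refine Finset.sum_eq_zero fun k _ => ?_
    have : f k x = 0 := congrFun hx k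
    simp [this]
  obtain ⟨g, hg⟩ := LinearMap.exists_leftInverse_of_injective _ hinj
  refine ⟨fun k => φ (g (Pi.single k 1)), ?_⟩
  ext x
  have hx : g (LinearMap.pi f x) = x := LinearMap.congr_fun hg x
  conv_lhs => rw [← hx, pi_eq_sum_univ' (LinearMap.pi f x)]
  simp only [map_sum, map_smul, LinearMap.sum_apply, LinearMap.smul_apply, LinearMap.pi_apply, smul_eq_mul]
  refine Finset.sum_congr rfl fun k _ => ?_
  exact mul_comm _ _

end Functional

section Bound

variable {A H : Type*} [CStarAlgebra A] [CStarAlgebra H] [FiniteDimensional ℂ H]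

theorem exists_bound_slice (ρ : A →⋆ₐ[ℂ] A ⊗[ℂ] H) (φ : H →ₗ[ℂ] ℂ) :
    ∃ C : ℝ, ∀ a : A, ‖slice A φ (ρ a)‖ ≤ C * ‖a‖ := by
  let _ := CStarAlgebra.spectralOrder A
  have := CStarAlgebra.spectralOrderedRing A
  obtain ⟨m, f, hf, hspan⟩ := exists_separating_functionals (H := H)
  have hslice : ∀ X Y : A ⊗[ℂ] H, slice A regTrace (star X * Y) =
      ∑ k, star (slice A (f k) X) * slice A (f k) Y := by
    intro X Y
    induction X with
    | zero => simp
    | add X₁ X₂ h₁ h₂ => simp [add_mul, h₁, h₂, Finset.sum_add_distrib]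
    | tmul a h =>
      induction Y with
      | zero => simp
      | add Y₁ Y₂ h₁ h₂ => simp only [mul_add, map_add, h₁, h₂, Finset.sum_add_distrib]
      | tmul a' h' =>
        simp [hf, Finset.sum_smul, smul_smul, mul_comm]
  have hk : ∀ k a, ‖slice A (f k) (ρ a)‖ ^ 2 ≤ ‖(regTrace (1 : H))‖ * ‖(1 : A)‖ * ‖a‖ ^ 2 := by
    intro k a
    have h1 : (0 : A) ≤ algebraMap ℝ A (‖a‖ ^ 2) - star a * a :=
      sub_nonneg.2 CStarAlgebra.star_mul_le_algebraMap_norm_sq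
    obtain ⟨c, hc⟩ := CStarAlgebra.nonneg_iff_eq_star_mul_self.1 h1
    have h2 : algebraMap ℂ A ((‖a‖ : ℂ) ^ 2) = star a * a + star c * c := by
      rw [← hc, IsScalarTower.algebraMap_apply ℝ ℂ A]
      simp
    have h3 := congrArg (fun x => slice A regTrace (ρ x)) h2
    simp only [AlgHomClass.commutes, map_add, map_mul, map_star, hslice,
      Algebra.TensorProduct.algebraMap_apply, slice_tmul] at h3
    have h4 : star (slice A (f k) (ρ a)) * slice A (f k) (ρ a) ≤
        regTrace (1 : H) • algebraMap ℂ A ((‖a‖ : ℂ) ^ 2) := by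
      rw [h3]
      calc _ ≤ ∑ k, star (slice A (f k) (ρ a)) * slice A (f k) (ρ a) :=
            Finset.single_le_sum (fun k _ => star_mul_self_nonneg (slice A (f k) (ρ a)))
              (Finset.mem_univ k)
        _ ≤ _ := le_add_of_nonneg_right (Finset.sum_nonneg fun k _ => star_mul_self_nonneg _)
    have h5 := CStarAlgebra.norm_le_norm_of_nonneg_of_le (star_mul_self_nonneg _) h4
    rw [CStarRing.norm_star_mul_self, ← sq] at h5
    refine h5.trans (le_of_eq ?_)
    rw [norm_smul, norm_algebraMap]
    simp
    ring
  have hk' : ∀ k, ∃ C : ℝ, ∀ a, ‖slice A (f k) (ρ a)‖ ≤ C * ‖a‖ := by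
    intro k
    refine ⟨√(‖(regTrace (1 : H))‖ * ‖(1 : A)‖), fun a => ?_⟩
    refine abs_le_of_sq_le_sq' ?_ (by positivity) |>.2
    rw [mul_pow, Real.sq_sqrt (by positivity)]
    exact hk k a
  choose C hC using hk'
  obtain ⟨c, rfl⟩ := hspan φ
  refine ⟨∑ k, ‖c k‖ * C k, fun a => ?_⟩
  have : slice A (∑ k, c k • f k) (ρ a) = ∑ k, c k • slice A (f k) (ρ a) := by
    induction ρ a with
    | zero => simp
    | add X₁ X₂ h₁ h₂ => simp [h₁, h₂, Finset.sum_add_distrib]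
    | tmul a h => simp [Finset.sum_smul, smul_smul]
  rw [this, Finset.sum_mul]
  refine (norm_sum_le _ _).trans (Finset.sum_le_sum fun k _ => ?_)
  rw [norm_smul, mul_assoc]
  exact mul_le_mul_of_nonneg_left (hC k a) (norm_nonneg _)

end Bound
section WeakCoaction

/-- A weak coaction of `H` on `A`: a unital `*`-homomorphism `ρ : A → A ⊗ H` such that
`(id ⊗ ε) (ρ a) = a`. As `H` is finite-dimensional, the algebraic tensor product is the
`C*`-tensor product. -/
structure WeakCoaction (A H : Type*) [CStarAlgebra A] [CStarHopfAlgebra H] where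
  /-- The underlying unital `*`-homomorphism. -/
  hom : A →⋆ₐ[ℂ] A ⊗[ℂ] H
  slice_counit : ∀ a : A, slice A CoalgebraStruct.counit (hom a) = a

namespace WeakCoaction

variable {A H : Type*} [CStarAlgebra A] [CStarHopfAlgebra H] [FiniteDimensional ℂ H]
  (ρ : WeakCoaction A H)

/-- The bounded linear map `(id ⊗ φ) ∘ ρ : A → A`. -/
def sliceHom (φ : H →ₗ[ℂ] ℂ) : A →L[ℂ] A :=
  LinearMap.mkContinuousOfExistsBound (slice A φ ∘ₗ ρ.hom.toAlgHom.toLinearMap)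
    (exists_bound_slice ρ.hom φ)

theorem sliceHom_apply (φ : H →ₗ[ℂ] ℂ) (a : A) : ρ.sliceHom φ a = slice A φ (ρ.hom a) := rfl

/-- The map `ρ^∞ : A^∞ → A^∞ ⊗ H`, `(aₙ) ↦ (ρ aₙ)`, where `A^∞ ⊗ H = (A ⊗ H)^∞`. Expanding
`ρ aₙ = ∑ᵢ (id ⊗ bᵢ*) (ρ aₙ) ⊗ bᵢ` in a basis `(bᵢ)` of `H`, the class of `(aₙ)` is sent to
`∑ᵢ [((id ⊗ bᵢ*) (ρ aₙ))ₙ] ⊗ bᵢ`. -/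
def homInf : AInf A →ₗ[ℂ] AInf A ⊗[ℂ] H :=
  ∑ i, ((TensorProduct.mk ℂ (AInf A) H).flip (Module.finBasis ℂ H i)) ∘ₗ
    mapInf (ρ.sliceHom ((Module.finBasis ℂ H).coord i))

/-- The basis-free meaning of `ρ^∞`: if `Y = ∑ⱼ yⱼ ⊗ hⱼ` in `ℓ^∞(ℕ, A) ⊗ H` satisfies
`ρ aₙ = ∑ⱼ yⱼ(n) ⊗ hⱼ` for all `n`, then `ρ^∞ [(aₙ)] = ∑ⱼ [yⱼ] ⊗ hⱼ`. -/
theorem homInf_toAInf (a : ℕ →ᵇ A) {ι : Type*} (s : Finset ι) (y : ι → (ℕ →ᵇ A)) (h : ι → H)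
    (ha : ∀ n, ρ.hom (a n) = ∑ j ∈ s, y j n ⊗ₜ[ℂ] h j) :
    ρ.homInf (toAInf A a) = ∑ j ∈ s, toAInf A (y j) ⊗ₜ[ℂ] h j := by
  have h1 : ∀ φ : H →ₗ[ℂ] ℂ, mapInf (ρ.sliceHom φ) (toAInf A a) =
      ∑ j ∈ s, φ (h j) • toAInf A (y j) := by
    intro φ
    rw [mapInf_toAInf]
    simp only [← map_smul, ← map_sum]
    congr 1
    ext n
    simp [sliceHom_apply, ha]
  simp only [homInf, LinearMap.sum_apply, LinearMap.comp_apply, LinearMap.flip_apply,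
    TensorProduct.mk_apply, h1, TensorProduct.sum_tmul, Module.Basis.coord_apply]
  rw [Finset.sum_comm]
  refine Finset.sum_congr rfl fun j _ => ?_
  conv_rhs => rw [← (Module.finBasis ℂ H).sum_repr (h j), TensorProduct.tmul_sum]
  exact Finset.sum_congr rfl fun i _ => (TensorProduct.smul_tmul _ _ _)

/-- The Rohlin property of a weak coaction: there is a unital injective `*`-homomorphism
`π : H → A_∞` with `ρ^∞ (π h) = π h₍₁₎ ⊗ h₍₂₎` for all `h`. -/
def HasRohlinProperty : Prop :=
  ∃ π : H →⋆ₐ[ℂ] centralSeq A, Function.Injective π ∧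
    ∀ h : H, ρ.homInf (π h : AInf A) =
      ((centralSeq A).subtype.toAlgHom.toLinearMap ∘ₗ π.toAlgHom.toLinearMap).rTensor H
        (CoalgebraStruct.comul h)

end WeakCoaction

end WeakCoaction

end CStarHopf

end

/-! Write `f : H → A^∞` for `π` followed by the inclusion. The antipode identity `1 ⊗ h = (f(S h₍₁₎)
⊗ 1)(f(h₍₂₎) ⊗ h₍₃₎)` shows that `f(H) ⊗ 1` and `(f ⊗ id)Δ(H) = ρ^∞(f(H))` together generate `1 ⊗
H`; this is `commute_one_tmul_of_commute_rTensor_comul`, and it is used twice. Since `f(H)` commutes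
with the constants `A`, multiplicativity of `ρ^∞` makes `ρ^∞(f(H))` commute with `ρ(A)`. So does
`f(H) ⊗ 1`, which commutes with all of `A ⊗ H`. Hence `1 ⊗ H` commutes with `ρ(A)`, and termwise
with `ρ^∞(A^∞)`, which contains `ρ^∞(f(H))`. As `1 ⊗ H` also commutes with `f(H) ⊗ 1`, it commutes
with itself. -/

open scoped TensorProduct BoundedContinuousFunction

noncomputable section

namespace CStarHopf

/-! ### Slice maps separate points of the tensor product -/

section SliceExpansion

variable {V W H : Type*} [AddCommGroup V] [Module ℂ V] [AddCommGroup W] [Module ℂ W]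
  [AddCommGroup H] [Module ℂ H]

theorem sum_slice_coord_tmul {ι : Type*} [Fintype ι] (b : Module.Basis ι ℂ H) (X : V ⊗[ℂ] H) :
    ∑ i, slice V (b.coord i) X ⊗ₜ[ℂ] b i = X := by
  induction X with
  | zero => simp
  | add X Y hX hY => simp only [map_add, TensorProduct.add_tmul, Finset.sum_add_distrib, hX, hY]
  | tmul v h =>
    conv_rhs => rw [← b.sum_repr h, TensorProduct.tmul_sum]
    refine Finset.sum_congr rfl fun i _ => ?_
    rw [slice_tmul, Module.Basis.coord_apply, TensorProduct.smul_tmul]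

theorem eq_zero_of_slice_eq_zero [FiniteDimensional ℂ H] {X : V ⊗[ℂ] H}
    (h : ∀ φ : H →ₗ[ℂ] ℂ, slice V φ X = 0) : X = 0 := by
  rw [← sum_slice_coord_tmul (Module.finBasis ℂ H) X]
  exact Finset.sum_eq_zero fun i _ => by rw [h, TensorProduct.zero_tmul]

theorem slice_rTensor (f : V →ₗ[ℂ] W) (φ : H →ₗ[ℂ] ℂ) (X : V ⊗[ℂ] H) :
    slice W φ (f.rTensor H X) = f (slice V φ X) := by
  induction X with
  | zero => simp
  | add X Y hX hY => simp only [map_add, hX, hY]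
  | tmul v h => simp

/-- Slicing commutes with `f`, so every slice of a kernel element is killed by `f`. -/
theorem rTensor_injective [FiniteDimensional ℂ H] {f : V →ₗ[ℂ] W} (hf : Function.Injective f) :
    Function.Injective (f.rTensor H) := by
  refine (injective_iff_map_eq_zero _).2 fun X hX => eq_zero_of_slice_eq_zero fun φ => hf ?_
  rw [← slice_rTensor, hX, map_zero, map_zero]

end SliceExpansion

/-! ### The antipode identity and commutants -/

section HopfGeneration

variable {H B : Type*} [Ring H] [HopfAlgebra ℂ H] [Ring B] [Algebra ℂ B]

open HopfAlgebra in
/-- An element commuting with `f(H) ⊗ 1` and with `(f ⊗ id)(Δ(H))` commutes with `1 ⊗ H`, because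
`1 ⊗ h = (f(S h₍₁₎) ⊗ 1) * (f(h₍₂₎) ⊗ h₍₃₎)`. -/
theorem commute_one_tmul_of_commute_rTensor_comul (f : H →ₐ[ℂ] B) {R : B ⊗[ℂ] H}
    (h₁ : ∀ h : H, Commute (f h ⊗ₜ[ℂ] (1 : H)) R)
    (h₂ : ∀ h : H, Commute (f.toLinearMap.rTensor H (CoalgebraStruct.comul h)) R) (h : H) :
    Commute ((1 : B) ⊗ₜ[ℂ] h) R := by
  let L : H →ₗ[ℂ] B ⊗[ℂ] H :=
    (TensorProduct.mk ℂ B H).flip 1 ∘ₗ f.toLinearMap ∘ₗ antipode ℂ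
  let D : H →ₗ[ℂ] B ⊗[ℂ] H := f.toLinearMap.rTensor H ∘ₗ CoalgebraStruct.comul
  -- `M (x ⊗ y) = (f(S x) ⊗ 1) * (f ⊗ id)(Δ y)`, a product of two elements commuting with `R`.
  let M : H ⊗[ℂ] H →ₗ[ℂ] B ⊗[ℂ] H := LinearMap.mul' ℂ (B ⊗[ℂ] H) ∘ₗ TensorProduct.map L D
  have hM : ∀ X : H ⊗[ℂ] H, Commute (M X) R := by
    intro X
    induction X with
    | zero => simp [M]
    | add X Y hX hY => rw [map_add]; exact hX.add_left hY
    | tmul x y => exact (h₁ (antipode ℂ x)).mul_left (h₂ y)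
  -- `N ((x ⊗ y) ⊗ z) = f(S(x) y) ⊗ z`, so that the antipode axiom applies to the first two legs.
  let N : (H ⊗[ℂ] H) ⊗[ℂ] H →ₗ[ℂ] B ⊗[ℂ] H :=
    (f.toLinearMap ∘ₗ LinearMap.mul' ℂ H ∘ₗ (antipode ℂ).rTensor H).rTensor H
  have hN : ∀ (x : H) (Y : H ⊗[ℂ] H), LinearMap.mul' ℂ (B ⊗[ℂ] H)
      (L x ⊗ₜ f.toLinearMap.rTensor H Y) = N ((TensorProduct.assoc ℂ H H H).symm (x ⊗ₜ Y)) := by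
    intro x Y
    induction Y with
    | zero => simp
    | add Y Z hY hZ => simp only [map_add, TensorProduct.tmul_add, hY, hZ]
    | tmul y z => simp [L, N]
  have hMN : ∀ X : H ⊗[ℂ] H, M X = N ((TensorProduct.assoc ℂ H H H).symm
      ((CoalgebraStruct.comul (R := ℂ) (A := H)).lTensor H X)) := by
    intro X
    induction X with
    | zero => simp
    | add X Y hX hY => simp only [map_add, hX, hY]
    | tmul x y => exact hN x _
  have hcounit : ∀ X : H ⊗[ℂ] H,
      N ((CoalgebraStruct.comul (R := ℂ) (A := H)).rTensor H X) =
        (Algebra.linearMap ℂ B).rTensor H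
          ((CoalgebraStruct.counit (R := ℂ) (A := H)).rTensor H X) := by
    intro X
    induction X with
    | zero => simp
    | add X Y hX hY => simp only [map_add, hX, hY]
    | tmul x y =>
      simp only [N, LinearMap.rTensor_tmul, LinearMap.comp_apply,
        HopfAlgebra.mul_antipode_rTensor_comul_apply]
      simp
  -- Coassociativity turns `(id ⊗ Δ)Δ` into `(Δ ⊗ id)Δ`; the antipode and counit axioms then leave
  -- `1 ⊗ h`.
  have key : M (CoalgebraStruct.comul h) = (1 : B) ⊗ₜ[ℂ] h := by
    rw [hMN, Coalgebra.coassoc_symm_apply, hcounit, Coalgebra.rTensor_counit_comul]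
    simp
  exact key ▸ hM _

end HopfGeneration

/-! ### Constant sequences in `A^∞` -/

section ConstantSequences

variable (A : Type*) [CStarAlgebra A]

/-- The embedding of `A` into `A^∞` by constant sequences. -/
def constInf : A →ₐ[ℂ] AInf A where
  toFun a := toAInf A (BoundedContinuousFunction.const ℕ a)
  map_one' := map_one (toAInf A)
  map_mul' a b := map_mul (toAInf A) (BoundedContinuousFunction.const ℕ a) (.const ℕ b)
  map_zero' := map_zero (toAInf A)
  map_add' a b := map_add (toAInf A) (BoundedContinuousFunction.const ℕ a) (.const ℕ b)
  commutes' c := (toAInf A).toAlgHom.commutes c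

theorem constInf_apply (a : A) :
    constInf A a = toAInf A (BoundedContinuousFunction.const ℕ a) := rfl

theorem constInf_injective : Function.Injective (constInf A) := by
  refine (injective_iff_map_eq_zero _).2 fun a ha => ?_
  rw [constInf_apply, toAInf_eq_zero] at ha
  exact norm_eq_zero.1 (tendsto_nhds_unique tendsto_const_nhds ha)

end ConstantSequences

/-! ### Multiplicativity of `ρ^∞` and passage from `A` to `A^∞` -/

namespace WeakCoaction

variable {A H : Type*} [CStarAlgebra A] [CStarHopfAlgebra H] [FiniteDimensional ℂ H]
  (ρ : WeakCoaction A H)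

theorem sum_sliceHom_tmul (a : A) :
    ∑ i, ρ.sliceHom ((Module.finBasis ℂ H).coord i) a ⊗ₜ[ℂ] Module.finBasis ℂ H i = ρ.hom a :=
  sum_slice_coord_tmul _ _

theorem homInf_toAInf_eq_sum (a : ℕ →ᵇ A) : ρ.homInf (toAInf A a) =
    ∑ i, toAInf A ((ρ.sliceHom ((Module.finBasis ℂ H).coord i)).compLeftContinuousBounded ℕ a)
      ⊗ₜ[ℂ] Module.finBasis ℂ H i :=
  ρ.homInf_toAInf a _ _ _ fun n => (ρ.sum_sliceHom_tmul (a n)).symm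

/-- `homInf_toAInf` accepts any finite expansion, not only one in a basis, so the termwise product
of two expansions computes `ρ^∞` of the product. -/
theorem homInf_toAInf_mul {ι κ : Type*} [Fintype ι] [Fintype κ] {a b : ℕ →ᵇ A}
    (s : ι → (ℕ →ᵇ A)) (t : κ → (ℕ →ᵇ A)) (h : ι → H) (k : κ → H)
    (ha : ∀ n, ρ.hom (a n) = ∑ i, s i n ⊗ₜ[ℂ] h i)
    (hb : ∀ n, ρ.hom (b n) = ∑ j, t j n ⊗ₜ[ℂ] k j) :
    ρ.homInf (toAInf A (a * b)) = ρ.homInf (toAInf A a) * ρ.homInf (toAInf A b) := by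
  have hab : ∀ n, ρ.hom ((a * b) n) =
      ∑ p : ι × κ, (s p.1 * t p.2) n ⊗ₜ[ℂ] (h p.1 * k p.2) := by
    intro n
    rw [BoundedContinuousFunction.mul_apply, map_mul, ha n, hb n, Finset.sum_mul_sum,
      Fintype.sum_prod_type]
    simp only [Algebra.TensorProduct.tmul_mul_tmul, BoundedContinuousFunction.mul_apply]
  have h₁ := ρ.homInf_toAInf (a * b) Finset.univ (fun p : ι × κ => s p.1 * t p.2)
    (fun p => h p.1 * k p.2) hab
  have h₂ := ρ.homInf_toAInf a Finset.univ s h ha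
  have h₃ := ρ.homInf_toAInf b Finset.univ t k hb
  rw [h₁, h₂, h₃, Finset.sum_mul_sum, Fintype.sum_prod_type]
  simp only [Algebra.TensorProduct.tmul_mul_tmul, map_mul]

theorem homInf_mul (x y : AInf A) : ρ.homInf (x * y) = ρ.homInf x * ρ.homInf y := by
  obtain ⟨a, rfl⟩ := toAInf_surjective A x
  obtain ⟨b, rfl⟩ := toAInf_surjective A y
  have h := ρ.homInf_toAInf_mul
    (fun i => (ρ.sliceHom ((Module.finBasis ℂ H).coord i)).compLeftContinuousBounded ℕ a)
    (fun i => (ρ.sliceHom ((Module.finBasis ℂ H).coord i)).compLeftContinuousBounded ℕ b)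
    _ _ (fun n => (ρ.sum_sliceHom_tmul (a n)).symm) (fun n => (ρ.sum_sliceHom_tmul (b n)).symm)
  rw [map_mul] at h
  exact h

theorem homInf_constInf (a : A) :
    ρ.homInf (constInf A a) = (constInf A).toLinearMap.rTensor H (ρ.hom a) := by
  rw [constInf_apply, homInf_toAInf_eq_sum, ← ρ.sum_sliceHom_tmul a, map_sum]
  rfl

/-- If `1 ⊗ h` commutes with `ρ(A)`, then it commutes with `ρ^∞(A^∞)`. -/
theorem commute_one_tmul_homInf {h : H} (hh : ∀ a : A, Commute ((1 : A) ⊗ₜ[ℂ] h) (ρ.hom a))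
    (x : AInf A) : Commute ((1 : AInf A) ⊗ₜ[ℂ] h) (ρ.homInf x) := by
  obtain ⟨a, rfl⟩ := toAInf_surjective A x
  refine sub_eq_zero.1 (eq_zero_of_slice_eq_zero fun φ => ?_)
  have h₀ : ∀ n, slice A φ ((1 : A) ⊗ₜ[ℂ] h * ρ.hom (a n) - ρ.hom (a n) * (1 : A) ⊗ₜ[ℂ] h) = 0 :=
    fun n => by rw [(hh (a n)).eq, sub_self, map_zero]
  simp only [← ρ.sum_sliceHom_tmul, Finset.mul_sum, Finset.sum_mul,
    Algebra.TensorProduct.tmul_mul_tmul, one_mul, mul_one, map_sub, map_sum, slice_tmul] at h₀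
  simp only [homInf_toAInf_eq_sum, Finset.mul_sum, Finset.sum_mul,
    Algebra.TensorProduct.tmul_mul_tmul, one_mul, mul_one, map_sub, map_sum, slice_tmul]
  -- The slice of the commutator becomes the class of one bounded sequence, whose terms vanish by
  -- `h₀`.
  simp only [← map_smul, ← map_sum, ← map_sub]
  refine (congrArg (toAInf A) ?_).trans (map_zero _)
  ext n
  simpa using h₀ n

end WeakCoaction

end CStarHopf

end

/-! ### Commutativity of `H` -/

open CStarHopf in
theorem mainTheorem11 {A H : Type*} [CStarAlgebra A] [CStarHopfAlgebra H]
    [FiniteDimensional ℂ H] (ρ : CStarHopf.WeakCoaction A H) (hρ : ρ.HasRohlinProperty) :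
    ∀ x y : H, x * y = y * x := by
  obtain ⟨π, hinj, hπ⟩ := hρ
  let f : H →ₐ[ℂ] AInf A := (centralSeq A).subtype.toAlgHom.comp π.toAlgHom
  have hf : ∀ h, ρ.homInf (f h) = f.toLinearMap.rTensor H (CoalgebraStruct.comul h) := hπ
  have hcomm : ∀ (h : H) (a : A), Commute (f h) (constInf A a) := fun h a =>
    ((mem_centralSeq A).1 (π h).2 a).symm
  have hleft : ∀ (h : H) (X : A ⊗[ℂ] H),
      Commute (f h ⊗ₜ[ℂ] (1 : H)) ((constInf A).toLinearMap.rTensor H X) := by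
    intro h X
    induction X with
    | zero => simp
    | add X Y hX hY => rw [map_add]; exact hX.add_right hY
    | tmul a k =>
      rw [LinearMap.rTensor_tmul, commute_iff_eq, Algebra.TensorProduct.tmul_mul_tmul,
        Algebra.TensorProduct.tmul_mul_tmul, one_mul, mul_one]
      exact congrArg (· ⊗ₜ[ℂ] k) (hcomm h a).eq
  have hconst : ∀ (h : H) (a : A), Commute ((1 : A) ⊗ₜ[ℂ] h) (ρ.hom a) := by
    intro h a
    have h₁ : Commute ((1 : AInf A) ⊗ₜ[ℂ] h) ((constInf A).toLinearMap.rTensor H (ρ.hom a)) := by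
      refine commute_one_tmul_of_commute_rTensor_comul f (fun k => hleft k _) (fun k => ?_) h
      -- Both factors lie in the image of `ρ^∞`, so this is `ρ^∞` applied to the commutation of `f
      -- k` with `a`.
      rw [← hf, ← ρ.homInf_constInf, commute_iff_eq, ← ρ.homInf_mul, ← ρ.homInf_mul,
        (hcomm k a).eq]
    -- The relation descends from `A^∞ ⊗ H` to `A ⊗ H` along this embedding.
    let F := Algebra.TensorProduct.map (constInf A) (AlgHom.id ℂ H)
    have hF : Function.Injective F := rTensor_injective (constInf_injective A)
    refine hF ?_
    rw [map_mul, map_mul]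
    have h₂ : F ((1 : A) ⊗ₜ[ℂ] h) = (1 : AInf A) ⊗ₜ[ℂ] h := by simp [F]
    rw [h₂]
    exact h₁
  intro x y
  have hxy : Commute ((1 : AInf A) ⊗ₜ[ℂ] y) ((1 : AInf A) ⊗ₜ[ℂ] x) := by
    refine commute_one_tmul_of_commute_rTensor_comul f (fun k => ?_) (fun k => ?_) y
    · simp [commute_iff_eq]
    · rw [← hf]
      exact (ρ.commute_one_tmul_homInf (hconst x) (f k)).symm
  -- Cancelling `1 ⊗` needs `1 ≠ 0` in `A^∞`; if `A^∞ = 0`, injectivity of `π` forces `H = 0`.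
  rcases subsingleton_or_nontrivial (AInf A) with hA | hA
  · exact hinj (Subtype.ext (Subsingleton.elim _ _))
  · rw [commute_iff_eq, Algebra.TensorProduct.tmul_mul_tmul,
      Algebra.TensorProduct.tmul_mul_tmul, one_mul] at hxy
    refine (Module.forall_dual_apply_eq_zero_iff ℂ (x * y - y * x)).1 (fun φ => ?_) |> sub_eq_zero.1
    have h₁ := congrArg (slice (AInf A) φ) hxy
    rw [slice_tmul, slice_tmul] at h₁
    rw [map_sub, sub_eq_zero]
    exact (smul_left_injective ℂ (one_ne_zero (α := AInf A)) h₁).symm
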